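/- For any uncountable cardinal $\kappa$, the following four statements are equivalent, where $2^\omega$ is the Cantor space and $\omega^\omega$ is the Baire space (each with the product topology, the factors being discrete), and a partition of $X$ into $\kappa$ sets is a family, of cardinality exactly $\kappa$, of pairwise disjoint nonempty subsets of $X$ with union $X$: 1. There is a partition of $2^\omega$ into $\kappa$ closed sets. 2. There is a partition of $\omega^\omega$ into $\kappa$ compact sets. 3. For every uncountable Polish space $X$, there is a partition of $X$ into $\kappa$ compact sets. 4. For some uncountable compact Polish space $X$, there is a partition of $X$ into $\kappa$ $F_\sigma$ sets (an $F_\sigma$ set is a countable union of closed sets). -/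

import Mathlib

universe u v w

open Cardinal

/-- `A` is an `F_σ` set: a union of countably many closed sets. -/
def IsFSigma {X : Type v} [TopologicalSpace X] (A : Set X) : Prop :=
  ∃ F : ℕ → Set X, (∀ n, IsClosed (F n)) ∧ A = ⋃ n, F n

/-- There is a partition of `X` into (exactly) `κ` sets having the property `Γ`: a family `P` of
pairwise disjoint nonempty subsets of `X` covering `X`, each with property `Γ`, such that the
cardinality of `P` is `κ`. The cardinals are lifted to a common universe. -/
def HasPartitionInto (X : Type v) (κ : Cardinal.{u}) (Γ : Set X → Prop) : Prop :=
  ∃ P : Set (Set X), Setoid.IsPartition P ∧ (∀ A ∈ P, Γ A) ∧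
    Cardinal.lift.{u} #P = Cardinal.lift.{v} κ

/-! The implications run 1 → 3 → 2 → 4 → 1, with partitions handled as labellings. Extra countable
data, one extra cell or a second copy of the labels do not change `κ`.

The weight is in 1 → 3. From uncountably many closed cells of the Cantor space,
`exists_baire_isCompact_fibers` builds a tree of cylinders in which each cell meets only finitely
many children of a node; the branch map from the Baire space then pulls cells back to compact sets.
An uncountable Polish space is a Cantor set, partitioned as given, plus an open remainder, which
`PolishSpace.exists_isCompact_preimage` maps to the Baire space.

For 2 → 4 the Baire space sits in a compact space with `F_σ` complement. For 4 → 1 pull back along a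
surjection from the Cantor space, then refine `F_σ` cells to closed ones. -/

theorem HasPartitionInto.exists_label {X : Type v} {κ : Cardinal.{u}} {Γ : Set X → Prop}
    (h : HasPartitionInto X κ Γ) :
    ∃ (ι : Type v) (c : X → ι), Function.Surjective c ∧ (∀ i, Γ (c ⁻¹' {i})) ∧
      lift.{u} #ι = lift.{v} κ := by
  obtain ⟨P, hP, hΓ, hcard⟩ := h
  choose b hb using fun x => (hP.2 x).exists
  have key : ∀ x (A : P), x ∈ A.1 ↔ b x = A.1 := fun x A =>
    ⟨fun hx => (hP.2 x).unique (hb x) ⟨A.2, hx⟩, fun h => h ▸ (hb x).2⟩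
  refine ⟨P, fun x => ⟨b x, (hb x).1⟩, fun A => ?_, fun A => ?_, hcard⟩
  · obtain ⟨x, hx⟩ := Setoid.nonempty_of_mem_partition hP A.2
    exact ⟨x, Subtype.ext ((key x A).1 hx)⟩
  · convert hΓ A A.2 using 1
    ext x
    simp [key x A, Subtype.ext_iff]

theorem HasPartitionInto.of_label {X : Type v} {κ : Cardinal.{u}} {Γ : Set X → Prop}
    {ι : Type w} (c : X → ι) (hΓ : ∀ x, Γ (c ⁻¹' {c x}))
    (hcard : lift.{u} #(Set.range c) = lift.{w} κ) : HasPartitionInto X κ Γ := by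
  refine ⟨(Setoid.ker c).classes, Setoid.isPartition_classes _, ?_, ?_⟩
  · rintro _ ⟨x, rfl⟩
    exact hΓ x
  · have e : (Setoid.ker c).classes ≃ Set.range c :=
      (Setoid.quotientEquivClasses _).symm.trans (Setoid.quotientKerEquivRange c)
    have h1 : lift.{w} #(Setoid.ker c).classes = lift.{v} #(Set.range c) :=
      Cardinal.mk_congr_lift e
    rw [← Cardinal.lift_inj.{max u v, w}]
    have h4 := congrArg lift.{u} h1
    have h5 := congrArg lift.{v} hcard
    simp only [lift_lift] at h4 h5 ⊢
    exact h4.trans h5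

/-- A refinement of a surjective labelling of `X` by `ι` uses `#ι` labels, if at most that many are
available. -/
theorem Cardinal.mk_range_eq_of_factor {X : Type v} {ι ι' : Type w} (c : X → ι)
    (hc : Function.Surjective c) (c' : X → ι') (p : ι' → ι) (hp : ∀ x, p (c' x) = c x)
    (hle : #ι' ≤ #ι) : #(Set.range c') = #ι := by
  refine le_antisymm ((mk_set_le _).trans hle) ?_
  refine mk_le_of_surjective (f := fun y : Set.range c' => p y) fun i => ?_
  obtain ⟨x, rfl⟩ := hc i
  exact ⟨⟨c' x, x, rfl⟩, hp x⟩

theorem HasPartitionInto.comap {X : Type v} {Y : Type w} {κ : Cardinal.{u}} {Γ : Set X → Prop}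
    {Δ : Set Y → Prop} (h : HasPartitionInto X κ Γ) (f : Y → X) (hf : Function.Surjective f)
    (hΔ : ∀ A, Γ A → Δ (f ⁻¹' A)) : HasPartitionInto Y κ Δ := by
  obtain ⟨ι, c, hc, hΓ, hι⟩ := h.exists_label
  refine .of_label (c ∘ f) (fun x => hΔ _ (hΓ _)) ?_
  rw [(hc.comp hf).range_eq, mk_univ, hι]

theorem aleph0_lt_of_lift_eq {ι : Type v} {κ : Cardinal.{u}} (hκ : ℵ₀ < κ)
    (h : lift.{u} #ι = lift.{v} κ) : ℵ₀ < #ι := by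
  rw [← aleph0_lt_lift.{v, u}, h]
  exact aleph0_lt_lift.2 hκ

/-! ### `F_σ` partitions and their closed refinements -/

theorem IsFSigma.preimage {X : Type v} {Y : Type w} [TopologicalSpace X] [TopologicalSpace Y]
    {A : Set X} (hA : IsFSigma A) {f : Y → X} (hf : Continuous f) : IsFSigma (f ⁻¹' A) := by
  obtain ⟨F, hF, rfl⟩ := hA
  exact ⟨fun n => f ⁻¹' F n, fun n => (hF n).preimage hf, Set.preimage_iUnion⟩

theorem IsClosed.isFSigma {X : Type v} [TopologicalSpace X] {A : Set X} (hA : IsClosed A) :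
    IsFSigma A :=
  ⟨fun _ => A, fun _ => hA, (Set.iUnion_const A).symm⟩

theorem IsClosed.isFSigma_diff {X : Type v} [MetricSpace X] {A B : Set X} (hA : IsClosed A)
    (hB : IsClosed B) : IsFSigma (A \ B) := by
  obtain ⟨F, hF, -, hU, -⟩ := hB.isOpen_compl.exists_iUnion_isClosed
  exact ⟨fun n => A ∩ F n, fun n => hA.inter (hF n), by
    rw [← Set.inter_iUnion, hU, Set.sdiff_eq]⟩

/-- In a Cantor space, partitions into `F_σ` sets refine to partitions into closed sets. -/
theorem HasPartitionInto.isClosed_of_isFSigma {κ : Cardinal.{u}} (hκ : ℵ₀ < κ)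
    (h : HasPartitionInto (ℕ → Bool) κ IsFSigma) : HasPartitionInto (ℕ → Bool) κ IsClosed := by
  classical
  obtain ⟨ι, c, hc, hΓ, hι⟩ := h.exists_label
  choose F hF hcF using hΓ
  have hex : ∀ x, ∃ n, x ∈ F (c x) n := fun x => by
    have : x ∈ c ⁻¹' {c x} := rfl
    rwa [hcF, Set.mem_iUnion] at this
  have hsub : ∀ i n x, x ∈ F i n → c x = i := fun i n x hx => by
    have : x ∈ c ⁻¹' {i} := by rw [hcF]; exact Set.mem_iUnion.2 ⟨n, hx⟩
    exact this
  let n x := Nat.find (hex x)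
  let G i m : Set (ℕ → Bool) := ⋃ l ∈ Finset.range m, F i l
  have hG : ∀ i m, IsClosed (G i m) := fun i m => isClosed_biUnion_finset fun l _ => hF i l
  have hdis : ∀ x, ∃ k, Disjoint (G (c x) (n x)) (PiNat.cylinder x k) := fun x =>
    PiNat.exists_disjoint_cylinder (hG _ _) (by
      simp only [G, Set.mem_iUnion, Finset.mem_range, not_exists]
      exact fun l hl => Nat.find_min (hex x) hl)
  -- Fixing `c` and `n` alone gives a closed set minus a closed set. Recording also the least length
  -- of a cylinder missing the subtracted set makes the cell closed, as conditions on finitely many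
  -- coordinates are clopen.
  let k x := Nat.find (hdis x)
  have hcyl : ∀ i m j, IsClopen {x | Disjoint (G i m) (PiNat.cylinder x j)} := fun i m j => by
    have hloc : ∀ x y : ℕ → Bool, y ∈ PiNat.cylinder x j → PiNat.cylinder y j = PiNat.cylinder x j :=
      fun x y => PiNat.mem_cylinder_iff_eq.1
    have hopen : ∀ p : Set (ℕ → Bool) → Prop, IsOpen {x | p (PiNat.cylinder x j)} := fun p =>
      isOpen_iff_forall_mem_open.2 fun x hx => ⟨PiNat.cylinder x j, fun y hy => by
        simpa [hloc x y hy] using hx, PiNat.isOpen_cylinder _ x j, PiNat.self_mem_cylinder x j⟩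
    exact ⟨⟨hopen fun s => ¬ Disjoint (G i m) s⟩, hopen fun s => Disjoint (G i m) s⟩
  refine .of_label (fun x => (c x, n x, k x)) (fun x => ?_) ?_
  · have : (fun x => (c x, n x, k x)) ⁻¹' {(c x, n x, k x)} =
        F (c x) (n x) ∩ ({y | Disjoint (G (c x) (n x)) (PiNat.cylinder y (k x))} ∩
          ⋂ j ∈ Finset.range (k x), {y | Disjoint (G (c x) (n x)) (PiNat.cylinder y j)}ᶜ) := by
      ext y
      simp only [Set.mem_preimage, Set.mem_singleton_iff, Prod.mk.injEq, Set.mem_inter_iff,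
        Set.mem_ofPred_eq, Set.mem_iInter, Finset.mem_range, Set.mem_compl_iff]
      constructor
      · rintro ⟨h1, h2, h3⟩
        rw [← h1, ← h2, ← h3]
        exact ⟨Nat.find_spec (hex y), Nat.find_spec (hdis y), fun j hj =>
          Nat.find_min (hdis y) hj⟩
      · rintro ⟨h1, h2, h3⟩
        have hcy := hsub _ _ _ h1
        have hny : n y = n x := by
          rw [Nat.find_eq_iff]
          refine ⟨hcy ▸ h1, fun l hl hy => ?_⟩
          refine Set.disjoint_left.1 h2 ?_ (PiNat.self_mem_cylinder y _)
          simp only [G, Set.mem_iUnion, Finset.mem_range]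
          exact ⟨l, hl, hcy ▸ hy⟩
        refine ⟨hcy, hny, ?_⟩
        rw [Nat.find_eq_iff, hcy, hny]
        exact ⟨h2, h3⟩
    rw [this]
    exact (hF _ _).inter ((hcyl _ _ _).isClosed.inter
      (isClosed_biInter fun j _ => (hcyl _ _ _).compl.isClosed))
  · rw [mk_range_eq_of_factor c hc _ Prod.fst (fun x => rfl), hι]
    have : ℵ₀ < #ι := aleph0_lt_of_lift_eq hκ hι
    simpa using mul_le_of_le this.le le_rfl this.le

/-- The Baire space embeds in a compact Polish space with `F_σ` complement. -/
theorem HasPartitionInto.isFSigma_of_baire {κ : Cardinal.{u}} (hκ : ℵ₀ < κ)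
    (h : HasPartitionInto (ℕ → ℕ) κ IsCompact) :
    HasPartitionInto (ℕ → ℕ → Bool) κ IsFSigma := by
  classical
  obtain ⟨ι, c, hc, hΓ, hι⟩ := h.exists_label
  let e : (ℕ → ℕ) → (ℕ → ℕ → Bool) := fun x n m => decide (x n = m)
  have he : Continuous e := continuous_pi fun n => continuous_pi fun m =>
    (continuous_of_discreteTopology (f := fun k : ℕ => decide (k = m))).comp (continuous_apply n)
  have hinj : Function.Injective e := fun x y hxy => funext fun n => by
    have := congrFun (congrFun hxy n) (x n)
    simpa [e, eq_comm] using this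
  have hcompl : IsFSigma (Set.range e)ᶜ := by
    -- A point is not the graph of a function iff some row has no `true` or has two of them.
    refine ⟨fun n => {z | (∀ m, z n.unpair.1 m = false)} ∪
      {z | n.unpair.2.unpair.1 ≠ n.unpair.2.unpair.2 ∧ z n.unpair.1 n.unpair.2.unpair.1 = true ∧
        z n.unpair.1 n.unpair.2.unpair.2 = true}, fun n => ?_, ?_⟩
    · refine IsClosed.union ?_ ?_
      · simp only [Set.ofPred_forall]
        exact isClosed_iInter fun m => isClosed_eq (by fun_prop) (by fun_prop)
      · exact isClosed_const.and ((isClosed_eq (by fun_prop) (by fun_prop)).and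
          (isClosed_eq (by fun_prop) (by fun_prop)))
    · ext z
      simp only [Set.mem_compl_iff, Set.mem_range, Set.mem_iUnion, Set.mem_union, Set.mem_ofPred_eq]
      constructor
      · intro hz
        by_contra! H
        refine hz ?_
        choose x hx using fun n => by simpa using (H (Nat.pair n 0)).1
        refine ⟨x, funext fun n => funext fun m => ?_⟩
        have h2 := (H (Nat.pair n (Nat.pair (x n) m))).2
        simp only [Nat.unpair_pair] at h2
        by_cases hm : x n = m
        · subst hm
          exact (decide_eq_true rfl).trans (hx n).symm
        · exact (decide_eq_false hm).trans (Bool.eq_false_iff.2 (h2 hm (hx n))).symm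
      · rintro ⟨n, h1 | ⟨h1, h2, h3⟩⟩ ⟨x, rfl⟩
        · simpa [e] using h1 (x n.unpair.1)
        · simp only [e, decide_eq_true_eq] at h2 h3
          exact h1 (h2.symm.trans h3)
  let c' : (ℕ → ℕ → Bool) → Option ι := fun z =>
    if hz : z ∈ Set.range e then some (c hz.choose) else none
  have hce : ∀ x, c' (e x) = some (c x) := fun x => by
    have hx : e x ∈ Set.range e := ⟨x, rfl⟩
    simp only [c', hx, dif_pos]
    rw [hinj hx.choose_spec]
  have hnone : ∀ z, z ∉ Set.range e → c' z = none := fun z hz => by simp only [c', dif_neg hz]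
  have hι' := aleph0_lt_of_lift_eq hκ hι
  refine .of_label c' (fun z => ?_) ?_
  · by_cases hz : z ∈ Set.range e
    · obtain ⟨x, rfl⟩ := hz
      have : c' ⁻¹' {c' (e x)} = e '' (c ⁻¹' {c x}) := by
        ext w
        simp only [Set.mem_preimage, Set.mem_singleton_iff, Set.mem_image]
        constructor
        · intro hw
          by_cases hwr : w ∈ Set.range e
          · obtain ⟨y, rfl⟩ := hwr
            exact ⟨y, by simpa [hce] using hw, rfl⟩
          · simp [hce, hnone w hwr] at hw
        · rintro ⟨y, hy, rfl⟩
          simp [hce, hy]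
      rw [this]
      exact ((hΓ _).image he).isClosed.isFSigma
    · convert hcompl using 1
      ext w
      simp only [Set.mem_preimage, Set.mem_singleton_iff, hnone z hz, Set.mem_compl_iff]
      refine ⟨?_, hnone w⟩
      rintro hw ⟨y, rfl⟩
      simp [hce] at hw
  · rw [← hι]
    congr 1
    refine le_antisymm ((mk_set_le _).trans ?_) ?_
    · rw [mk_option, add_one_eq hι'.le]
    · refine mk_le_of_injective (f := fun i : ι => (⟨some i, by
        obtain ⟨x, rfl⟩ := hc i
        exact ⟨e x, hce x⟩⟩ : Set.range c')) fun i j hij => by simpa using hij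

/-! ### Compact preimages under maps to the Baire space -/

/-- A countable partition into `F_σ` sets has a countable refinement into `F_σ` sets of small
diameter whose closures lie in members of the original partition. -/
theorem exists_fine_refinement {Y : Type v} [MetricSpace Y] [SecondCountableTopology Y]
    (f : Y → ℕ) (hf : ∀ j, IsFSigma (f ⁻¹' {j})) {ε : ℝ} (hε : 0 < ε) :
    ∃ f' : Y → ℕ, (∀ j, IsFSigma (f' ⁻¹' {j})) ∧ (∀ y z, f' y = f' z → dist y z ≤ ε) ∧
      ∀ y, closure (f' ⁻¹' {f' y}) ⊆ f ⁻¹' {f y} := by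
  classical
  rcases isEmpty_or_nonempty Y with hY | hY
  · exact ⟨f, hf, fun y => isEmptyElim y, fun y => isEmptyElim y⟩
  choose F hF hfF using hf
  let q := TopologicalSpace.denseSeq Y
  let E : ℕ → Set Y := fun k =>
    F k.unpair.1 k.unpair.2.unpair.1 ∩ Metric.closedBall (q k.unpair.2.unpair.2) (ε / 2)
  have hE : ∀ k, IsClosed (E k) := fun k => (hF _ _).inter Metric.isClosed_closedBall
  have hEf : ∀ k y, y ∈ E k → f y = k.unpair.1 := fun k y hy => by
    have : y ∈ f ⁻¹' {k.unpair.1} := by rw [hfF]; exact Set.mem_iUnion.2 ⟨_, hy.1⟩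
    exact this
  have hex : ∀ y, ∃ k, y ∈ E k := fun y => by
    have : y ∈ f ⁻¹' {f y} := rfl
    rw [hfF, Set.mem_iUnion] at this
    obtain ⟨m, hm⟩ := this
    obtain ⟨i, hi⟩ := (TopologicalSpace.denseRange_denseSeq Y).exists_dist_lt y (half_pos hε)
    exact ⟨Nat.pair (f y) (Nat.pair m i), by simpa [E] using ⟨hm, hi.le⟩⟩
  let f' y := Nat.find (hex y)
  have hsub : ∀ k, f' ⁻¹' {k} ⊆ E k := by
    rintro _ y rfl
    exact Nat.find_spec (hex y)
  refine ⟨f', fun k => ?_, fun y z hyz => ?_, fun y => ?_⟩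
  · have : f' ⁻¹' {k} = E k \ ⋃ l ∈ Finset.range k, E l := by
      ext y
      simp [f', Nat.find_eq_iff]
    rw [this]
    exact (hE k).isFSigma_diff (isClosed_biUnion_finset fun l _ => hE l)
  · have h1 := (hsub _ (rfl : y ∈ f' ⁻¹' {f' y})).2
    have h2 := (hsub _ (hyz.symm : z ∈ f' ⁻¹' {f' y})).2
    linarith [dist_triangle_right y z (q (f' y).unpair.2.unpair.2), Metric.mem_closedBall.1 h1,
      Metric.mem_closedBall.1 h2]
  · intro z hz
    have hz := closure_minimal (hsub _) (hE _) hz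
    exact (hEf _ z hz).trans (hEf _ y (hsub _ rfl)).symm

/-- Every Polish space has a map to the Baire space along which compact sets pull back to compact
sets. -/
theorem PolishSpace.exists_isCompact_preimage (Y : Type v) [TopologicalSpace Y] [PolishSpace Y] :
    ∃ g : Y → ℕ → ℕ, ∀ K, IsCompact K → IsCompact (g ⁻¹' K) := by
  let := TopologicalSpace.upgradeIsCompletelyMetrizable Y
  let S := {f : Y → ℕ // ∀ j, IsFSigma (f ⁻¹' {j})}
  choose R hR1 hR2 hR3 using fun (f : S) (n : ℕ) =>
    exists_fine_refinement f.1 f.2 (ε := (1 / 2 : ℝ) ^ n) (by positivity)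
  have h0 : ∀ j, IsFSigma ((fun _ : Y => (0 : ℕ)) ⁻¹' {j}) := fun j =>
    (isClosed_discrete {j}).preimage continuous_const |>.isFSigma
  let T : ℕ → S := fun n => Nat.rec ⟨_, h0⟩ (fun n f => ⟨R f n, hR1 f n⟩) n
  have hdist : ∀ n y z, (T (n + 1)).1 y = (T (n + 1)).1 z → dist y z ≤ (1 / 2 : ℝ) ^ n :=
    fun n => hR2 (T n) n
  have hcl : ∀ n y, closure ((T (n + 1)).1 ⁻¹' {(T (n + 1)).1 y}) ⊆ (T n).1 ⁻¹' {(T n).1 y} :=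
    fun n => hR3 (T n) n
  refine ⟨fun y n => (T n).1 y, fun K hK => ?_⟩
  refine IsSeqCompact.isCompact fun y hy => ?_
  obtain ⟨s, hs, φ, hφ, hlim⟩ := hK.isSeqCompact hy
  have hev : ∀ n, ∀ᶠ k in Filter.atTop, (T n).1 (y (φ k)) = s n := fun n => by
    have := (tendsto_pi_nhds.1 hlim) n
    rwa [nhds_discrete, Filter.tendsto_pure] at this
  have hcauchy : CauchySeq (y ∘ φ) := by
    refine Metric.cauchySeq_iff'.2 fun ε hε => ?_
    obtain ⟨n, hn⟩ := exists_pow_lt_of_lt_one hε (by norm_num : (1 / 2 : ℝ) < 1)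
    obtain ⟨N, hN⟩ := Filter.eventually_atTop.1 (hev (n + 1))
    exact ⟨N, fun k hk => (hdist n _ _ ((hN k hk).trans (hN N le_rfl).symm)).trans_lt hn⟩
  obtain ⟨a, ha⟩ := cauchySeq_tendsto_of_complete hcauchy
  refine ⟨a, ?_, φ, hφ, ha⟩
  -- `g` need not be continuous: the limit keeps its level `n` label because closures of level `n +
  -- 1` cells stay inside level `n` cells.
  have : (fun n => (T n).1 a) = s := funext fun n => by
    obtain ⟨k, hk, hk'⟩ := ((hev n).and (hev (n + 1))).exists
    rw [← hk]
    refine hcl n (y (φ k)) (mem_closure_of_tendsto ha ?_)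
    filter_upwards [hev (n + 1)] with l hl
    exact hl.trans hk'.symm
  change (fun n => (T n).1 a) ∈ K
  rwa [this]

/-! ### The tree of cylinders -/

/-- If a colouring of a second countable space uses uncountably many colours, then it is nowhere
locally constant on some nonempty subset. -/
theorem exists_nowhere_locally_constant {X : Type v} {ι : Type w} [TopologicalSpace X]
    [SecondCountableTopology X] (c : X → ι) (hc : ¬ (Set.range c).Countable) :
    ∃ K : Set X, K.Nonempty ∧ ∀ d ∈ K, ∀ U ∈ nhds d, ∃ d' ∈ U ∩ K, c d' ≠ c d := by
  -- Points all of whose neighbourhoods carry uncountably many colours; by second countability the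
  -- rest carries only countably many.
  let K : Set X := {d | ∀ U ∈ nhds d, ¬ (c '' U).Countable}
  have hB : (c '' Kᶜ).Countable := by
    have : ∀ d : X, ∃ U : Set X, d ∈ Kᶜ → U ∈ nhds d ∧ (c '' U).Countable := fun d => by
      by_cases hd : d ∈ Kᶜ
      · simp only [K, Set.mem_compl_iff, Set.mem_ofPred_eq, not_forall, not_not] at hd
        obtain ⟨U, hU, h⟩ := hd
        exact ⟨U, fun _ => ⟨hU, h⟩⟩
      · exact ⟨∅, fun h => absurd h hd⟩
    choose U hU using this
    obtain ⟨t, ht, htc, hcov⟩ := TopologicalSpace.countable_cover_nhdsWithin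
      (s := Kᶜ) (f := U) fun x hx => mem_nhdsWithin_of_mem_nhds (hU x hx).1
    refine ((htc.biUnion fun x hx => (hU x (ht hx)).2)).mono ((Set.image_mono hcov).trans ?_)
    simp only [Set.image_iUnion]
    exact subset_rfl
  have hK : ∀ U : Set X, ¬ (c '' U).Countable → ¬ (c '' (U ∩ K)).Countable := fun U hU h => by
    refine hU ((h.union hB).mono ?_)
    rw [← Set.image_union]
    refine Set.image_mono fun x hx => ?_
    by_cases hxK : x ∈ K
    · exact Or.inl ⟨hx, hxK⟩
    · exact Or.inr hxK
  refine ⟨K, ?_, fun d hd U hU => ?_⟩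
  · by_contra h
    rw [Set.not_nonempty_iff_eq_empty] at h
    rw [h, Set.compl_empty, Set.image_univ] at hB
    exact hc hB
  · by_contra! h
    refine hK U (hd U hU) ((Set.countable_singleton (c d)).mono ?_)
    rintro _ ⟨x, hx, rfl⟩
    exact h x hx

/-- A partition of the Cantor space into uncountably many closed sets pulls back to a partition
of the Baire space into compact sets, along a suitable map. -/
theorem exists_baire_isCompact_fibers {ι : Type w} (c : (ℕ → Bool) → ι)
    (hcl : ∀ i, IsClosed (c ⁻¹' {i})) (hc : ¬ (Set.range c).Countable) :
    ∃ ψ : (ℕ → ℕ) → ℕ → Bool, ∀ i, IsCompact (ψ ⁻¹' (c ⁻¹' {i})) := by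
  obtain ⟨K, ⟨d₀, hd₀⟩, hK⟩ := exists_nowhere_locally_constant c hc
  let S := {p : (ℕ → Bool) × ℕ // p.1 ∈ K}
  let C : S → Set (ℕ → Bool) := fun p => PiNat.cylinder p.1.1 p.1.2
  -- The children of a node converge to its point as `i` grows, while their cylinders avoid the
  -- colour of that point.
  have hstep : ∀ (p : S) (i : ℕ), ∃ q : S, q.1.1 ∈ PiNat.cylinder p.1.1 (p.1.2 + i) ∧
      p.1.2 + i < q.1.2 ∧ ∀ z ∈ C q, c z ≠ c p.1.1 := by
    intro p i
    obtain ⟨d, ⟨hd, hdK⟩, hne⟩ := hK _ p.2 _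
      ((PiNat.isOpen_cylinder _ p.1.1 (p.1.2 + i)).mem_nhds (PiNat.self_mem_cylinder _ _))
    obtain ⟨k, hk⟩ := PiNat.exists_disjoint_cylinder (hcl (c p.1.1)) (x := d) hne
    refine ⟨⟨(d, max k (p.1.2 + i + 1)), hdK⟩, hd,
      Nat.lt_of_succ_le (le_max_right _ _), fun z hz h => ?_⟩
    exact Set.disjoint_left.1 hk h (PiNat.cylinder_anti _ (le_max_left _ _) hz)
  choose step hmem hlt hne using hstep
  have hsub : ∀ p i, C (step p i) ⊆ PiNat.cylinder p.1.1 (p.1.2 + i) := fun p i z hz j hj =>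
    (hz j (hj.trans (hlt p i))).trans (hmem p i j hj)
  let st : (ℕ → ℕ) → ℕ → S := fun x k =>
    Nat.rec ⟨(d₀, 0), hd₀⟩ (fun k p => step p (x k)) k
  have hanti : ∀ x, Antitone fun k => C (st x k) := fun x => antitone_nat_of_succ_le fun k =>
    (hsub _ _).trans (PiNat.cylinder_anti _ (Nat.le_add_right _ _))
  have hlen : ∀ x k, k ≤ (st x k).1.2 := fun x k => by
    induction k with
    | zero => exact Nat.zero_le _
    | succ k ih => exact (ih.trans (Nat.le_add_right _ _)).trans_lt (hlt (st x k) (x k))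
  have hself : ∀ p : S, p.1.1 ∈ C p := fun p => PiNat.self_mem_cylinder _ _
  -- Stage `m + 1` has length at least `m + 1`, so it has settled coordinate `m`.
  let ψ : (ℕ → ℕ) → ℕ → Bool := fun x m => (st x (m + 1)).1.1 m
  have hψ : ∀ x k, ψ x ∈ C (st x k) := fun x k m hm => by
    rcases le_total k (m + 1) with h | h
    · exact hanti x h (hself _) m hm
    · exact (hanti x h (hself _) m (hlen x (m + 1))).symm
  have hloc : ∀ k, IsLocallyConstant fun x => st x k := fun k => by
    induction k with
    | zero => exact IsLocallyConstant.const _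
    | succ k ih =>
      have h : IsLocallyConstant fun x : ℕ → ℕ => x k :=
        (IsLocallyConstant.iff_continuous _).2 (continuous_apply k)
      exact ih.comp₂ h step
  have hcont : Continuous ψ := continuous_pi fun m =>
    ((hloc (m + 1)).comp fun p : S => p.1.1 m).continuous
  refine ⟨ψ, fun i => ?_⟩
  have hclosed : IsClosed (ψ ⁻¹' (c ⁻¹' {i})) := (hcl i).preimage hcont
  set B := ψ ⁻¹' (c ⁻¹' {i})
  -- If the point of `p` has colour `i`, all children miss the cell; otherwise a cylinder around the
  -- point misses the closed cell, and it contains all but finitely many children.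
  have hbound : ∀ (k : ℕ) (p : S), ∃ N, ∀ x ∈ B, st x k = p → x k < N := by
    intro k p
    by_cases hp : c p.1.1 = i
    · refine ⟨0, fun x hx hxp => absurd (Eq.trans hx hp.symm) ?_⟩
      rw [← hxp]
      exact hne _ _ _ (hψ x (k + 1))
    · obtain ⟨N, hN⟩ := PiNat.exists_disjoint_cylinder (hcl i) (x := p.1.1) hp
      refine ⟨N, fun x hx hxp => lt_of_not_ge fun hle => Set.disjoint_left.1 hN hx ?_⟩
      have : ψ x ∈ PiNat.cylinder p.1.1 (p.1.2 + x k) := by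
        rw [← hxp]
        exact hsub _ _ (hψ x (k + 1))
      exact PiNat.cylinder_anti _ (by omega) this
  choose N hN using hbound
  have heval : ∀ k, ((fun x => st x k) '' B).Finite → ((fun x => x k) '' B).Finite := by
    intro k hk
    refine (hk.biUnion fun p _ => Set.finite_Iio (N k p)).subset ?_
    rintro _ ⟨x, hx, rfl⟩
    exact Set.mem_biUnion ⟨x, hx, rfl⟩ (hN k _ x hx rfl)
  have hfin : ∀ k, ((fun x => st x k) '' B).Finite := by
    intro k
    induction k with
    | zero =>
      refine (Set.finite_singleton (⟨(d₀, 0), hd₀⟩ : S)).subset ?_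
      rintro _ ⟨x, -, rfl⟩
      rfl
    | succ k ih =>
      refine (ih.image2 step (heval k ih)).subset ?_
      rintro _ ⟨x, hx, rfl⟩
      exact ⟨_, ⟨x, hx, rfl⟩, _, ⟨x, hx, rfl⟩, rfl⟩
  refine (isCompact_univ_pi fun k => (heval k (hfin k)).isCompact).of_isClosed_subset hclosed ?_
  exact fun x hx k _ => ⟨x, hx, rfl⟩

/-! ### Transfer to Polish spaces and the equivalence -/

theorem HasPartitionInto.polish_of_cantor {κ : Cardinal.{u}} (hκ : ℵ₀ < κ)
    (h : HasPartitionInto (ℕ → Bool) κ IsClosed) (Y : Type v) [TopologicalSpace Y] [PolishSpace Y]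
    [Uncountable Y] : HasPartitionInto Y κ IsCompact := by
  obtain ⟨ι, c, hc, hcl, hι⟩ := h.exists_label
  have hι' := aleph0_lt_of_lift_eq hκ hι
  obtain ⟨ψ, hψ⟩ := exists_baire_isCompact_fibers c hcl (by
    rw [hc.range_eq, Set.countable_univ_iff, ← mk_le_aleph0_iff]
    exact hι'.not_ge)
  obtain ⟨f, -, hf, hinj⟩ := isClosed_univ.exists_nat_bool_injection_of_not_countable
    (α := Y) Set.not_countable_univ
  have hU : IsOpen (Set.range f)ᶜ := (isCompact_range hf).isClosed.isOpen_compl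
  have := hU.polishSpace
  obtain ⟨g, hg⟩ := PolishSpace.exists_isCompact_preimage ↥(Set.range f)ᶜ
  classical
  let e : (ℕ → Bool) ⊕ ↥(Set.range f)ᶜ ≃ Y :=
    ((Equiv.ofInjective f hinj).sumCongr (Equiv.refl _)).trans (Equiv.Set.sumCompl _)
  -- Some `inr` labels may be unused, but the `inl` ones all occur and already number `κ`.
  let m : (ℕ → Bool) ⊕ ↥(Set.range f)ᶜ → ι ⊕ ι := Sum.map c fun y => c (ψ (g y))
  refine .of_label (m ∘ e.symm) (fun y => ?_) ?_
  · rw [Set.preimage_comp, ← e.image_eq_preimage_symm]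
    generalize (m ∘ e.symm) y = j
    rcases j with i | i
    · have : e '' (m ⁻¹' {Sum.inl i}) = f '' (c ⁻¹' {i}) := by
        ext z
        constructor
        · rintro ⟨x | x, hx, rfl⟩
          · exact ⟨x, Sum.inl_injective hx, rfl⟩
          · cases hx
        · rintro ⟨x, hx, rfl⟩
          exact ⟨Sum.inl x, congrArg Sum.inl hx, rfl⟩
      rw [this]
      exact (hcl i).isCompact.image hf
    · have : e '' (m ⁻¹' {Sum.inr i}) = Subtype.val '' (g ⁻¹' (ψ ⁻¹' (c ⁻¹' {i}))) := by
        ext z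
        constructor
        · rintro ⟨x | x, hx, rfl⟩
          · cases hx
          · exact ⟨x, Sum.inr_injective hx, rfl⟩
        · rintro ⟨x, hx, rfl⟩
          exact ⟨Sum.inr x, congrArg Sum.inr hx, rfl⟩
      rw [this]
      exact (hg _ (hψ i)).image continuous_subtype_val
  · rw [e.symm.surjective.range_comp, ← hι]
    congr 1
    refine le_antisymm ((mk_set_le _).trans ?_) ?_
    · simp [add_eq_self hι'.le]
    · refine mk_le_of_injective (f := fun i : ι => (⟨Sum.inl i, by
        obtain ⟨x, rfl⟩ := hc i
        exact ⟨Sum.inl x, rfl⟩⟩ : Set.range m)) fun i j hij => by simpa using hij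

theorem lemma2p2 (κ : Cardinal.{u}) (hκ : ℵ₀ < κ) :
    List.TFAE
      [HasPartitionInto (ℕ → Bool) κ IsClosed,
       HasPartitionInto (ℕ → ℕ) κ IsCompact,
       ∀ (X : Type v) [TopologicalSpace X] [PolishSpace X] [Uncountable X],
         HasPartitionInto X κ IsCompact,
       ∃ (X : Type w) (_ : TopologicalSpace X) (_ : PolishSpace X) (_ : CompactSpace X)
         (_ : Uncountable X), HasPartitionInto X κ IsFSigma] := by
  tfae_have 1 → 3 := fun h X _ _ _ => h.polish_of_cantor hκ X
  tfae_have 3 → 2 := fun h => by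
    have : PolishSpace (ULift.{v} (ℕ → ℕ)) := Homeomorph.ulift.isClosedEmbedding.polishSpace
    have : Uncountable (ULift.{v} (ℕ → ℕ)) := by
      rw [← aleph0_lt_mk_iff]
      simpa using cantor' ℵ₀ one_lt_aleph0
    exact (h (ULift.{v} (ℕ → ℕ))).comap ULift.up ULift.up_surjective fun A hA =>
      Homeomorph.ulift.symm.isCompact_preimage.2 hA
  tfae_have 2 → 4 := fun h => by
    have : PolishSpace (ℕ → ℕ → Bool) := {}
    have : PolishSpace (ULift.{w} (ℕ → ℕ → Bool)) :=
      Homeomorph.ulift.isClosedEmbedding.polishSpace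
    have : Uncountable (ULift.{w} (ℕ → ℕ → Bool)) := by
      rw [← aleph0_lt_mk_iff]
      simpa using cantor ℵ₀
    exact ⟨ULift.{w} (ℕ → ℕ → Bool), inferInstance, inferInstance, inferInstance, inferInstance,
      (h.isFSigma_of_baire hκ).comap ULift.down ULift.down_surjective fun A hA =>
        hA.preimage continuous_uliftDown⟩
  tfae_have 4 → 1 := by
    rintro ⟨X, _, _, _, _, h⟩
    let := TopologicalSpace.upgradeIsCompletelyMetrizable X
    obtain ⟨f, hf, hsurj⟩ := exists_nat_bool_continuous_surjective_of_compact X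
    exact (h.comap f hsurj fun A hA => hA.preimage hf).isClosed_of_isFSigma hκ
  tfae_finish
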